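/- Throughout, posets are finite and $[n]=\{1,\dots,n\}$. A family $\mathcal G\subseteq 2^{[n]}$ is a (weak) copy of a poset $P$ if there is a bijection $\phi:P\to\mathcal G$ such that $x\le_P y$ implies $\phi(x)\subseteq\phi(y)$. A family $\mathcal F\subseteq 2^{[n]}$ is $P$-free if no subfamily of $\mathcal F$ is a copy of $P$. For posets $P$ and $Q$, with $P$ nonempty, let $La(n,P,Q)$ be the maximum, over all $P$-free families $\mathcal F\subseteq 2^{[n]}$, of the number of subfamilies of $\mathcal F$ that are copies of $Q$. Let $P_k$ denote the chain (totally ordered set) with $k$ elements. The height of a poset is the number of elements of a longest chain in it, and a poset is connected if its Hasse diagram is a connected graph. All asymptotic notation is for $n\to\infty$ with $P$ fixed. **Theorem.** (i) For every poset $P$ of height at least $3$, $$La(n,P,P_2)=\Theta\bigl(La(n,P_3,P_2)\bigr).$$ Moreover, for every $n$, $$La(n,P_3,P_2)\le La(n,P,P_2)\le La(n,P_{|P|},P_2)\le\left(\left\lfloor\frac{(|P|-1)^2}{4}\right\rfloor+o(1)\right)La(n,P_3,P_2).$$ (ii) For every connected poset $P$ of height $2$ with at least $3$ elements, $$La(n,P,P_2)=\Omega\left(\binom{n}{\lfloor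 n/2\rfloor}\right)\quad\text{and}\quad La(n,P,P_2)=O\left(n2^n\right).$$ -/

import Mathlib

open Asymptotics Filter Topology

/-- The height of a poset: the maximal number of elements of a chain in it. -/
noncomputable def posetHeight (P : Type*) [PartialOrder P] : ℕ∞ :=
  (Set.univ : Set P).chainHeight (· ≤ ·)

/-- A poset is connected if its Hasse diagram is a connected graph. -/
def PosetConnected (P : Type*) [PartialOrder P] : Prop :=
  (SimpleGraph.hasse P).Connected

/-- The family `𝒢` of subsets of `[n]` is a (weak) copy of `P`: there is a bijection from `P`
to `𝒢` that sends `x ≤ y` in `P` to an inclusion of sets. -/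
def IsCopy (P : Type*) [PartialOrder P] {n : ℕ} (𝒢 : Finset (Finset (Fin n))) : Prop :=
  ∃ φ : P ≃ {G : Finset (Fin n) // G ∈ 𝒢}, ∀ x y : P, x ≤ y → (φ x).1 ⊆ (φ y).1

/-- `𝓕` is `P`-free: no subfamily of `𝓕` is a copy of `P`. -/
def IsPosetFree (P : Type*) [PartialOrder P] {n : ℕ} (𝓕 : Finset (Finset (Fin n))) : Prop :=
  ∀ 𝒢 ⊆ 𝓕, ¬ IsCopy P 𝒢

open Classical in
/-- `c(Q, 𝓕)`: the number of subfamilies of `𝓕` that are copies of `Q`. -/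
noncomputable def copyCount (Q : Type*) [PartialOrder Q] {n : ℕ}
    (𝓕 : Finset (Finset (Fin n))) : ℕ :=
  (𝓕.powerset.filter fun 𝒢 => IsCopy Q 𝒢).card

open Classical in
/-- `La(n, P, Q)`: the maximum of `c(Q, 𝓕)` over the `P`-free families `𝓕` of subsets
of `[n]`. For nonempty `P` the empty family is `P`-free, so the maximum is over a nonempty
finite set. The chain `P_k` is `Fin k`. -/
noncomputable def La (n : ℕ) (P Q : Type*) [PartialOrder P] [PartialOrder Q] : ℕ :=
  ((Finset.univ : Finset (Finset (Finset (Fin n)))).filter fun 𝓕 => IsPosetFree P 𝓕).sup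
    fun 𝓕 => copyCount Q 𝓕

/-! Copies of $P_2$ are comparable pairs $A\subset B$. A monotone injection of posets makes `La`
monotone; mapping $P_3$ into $P$ and $P$ onto $P_{|P|}$ gives the first two inequalities of (i). For
the last, a maximal chain meets a $P_k$-free family in at most $k-1$ sets. If $x$ of them lie below
the middle level and $y$ above, it holds $xy\le\lfloor(k-1)^2/4\rfloor$ pairs straddling the middle.
Two full levels are $P_3$-free, so by symmetry each pair lies on at least a $1/La(n,P_3,P_2)$
fraction of the chains; double counting bounds the straddling pairs (`card_middle_pairs_le`). The
other pairs number $O((2\sqrt2)^n)$, negligible against $La(n,P_3,P_2)\ge(3^n-2^n)/(n+1)^2$. In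
(ii), the lower bound comes from a family whose comparability graph is a matching. For the upper
bound, every set $M$ has few members of the family below it or few above it
(`few_below_or_few_above`), and each pair is charged to a set or to a cube edge where this changes.
-/

/-! ### Copies as monotone injections, and comparable pairs -/

theorem three_le_posetHeight_iff {P : Type*} [PartialOrder P] :
    3 ≤ posetHeight P ↔ ∃ x y z : P, x < y ∧ y < z := by
  constructor
  · intro h
    obtain ⟨t, -, hcard, ht⟩ := Set.exists_isChain_of_le_chainHeight (r := (· ≤ ·)) 3 h
    obtain ⟨x, y, z, hxy, hxz, hyz, rfl⟩ := Set.encard_eq_three.1 hcard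
    have hxy' := ht.total (x := x) (y := y) (by simp) (by simp)
    have hxz' := ht.total (x := x) (y := z) (by simp) (by simp)
    have hyz' := ht.total (x := y) (y := z) (by simp) (by simp)
    have key : ∀ a b : P, a ≠ b → a ≤ b → a < b := fun a b h h' => lt_of_le_of_ne h' h
    rcases hxy' with h1 | h1 <;> rcases hxz' with h2 | h2 <;> rcases hyz' with h3 | h3
    · exact ⟨x, y, z, key _ _ hxy h1, key _ _ hyz h3⟩
    · exact ⟨x, z, y, key _ _ hxz h2, key _ _ hyz.symm h3⟩
    · exact ⟨x, y, z, key _ _ hxy h1, key _ _ hyz h3⟩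
    · exact ⟨z, x, y, key _ _ hxz.symm h2, key _ _ hxy h1⟩
    · exact ⟨y, x, z, key _ _ hxy.symm h1, key _ _ hxz h2⟩
    · exact ⟨z, y, x, key _ _ hyz.symm h3, key _ _ hxy.symm h1⟩
    · exact ⟨y, z, x, key _ _ hyz h3, key _ _ hxz.symm h2⟩
    · exact ⟨z, y, x, key _ _ hyz.symm h3, key _ _ hxy.symm h1⟩
  · rintro ⟨x, y, z, hxy, hyz⟩
    have hc : IsChain (· ≤ ·) ({x, y, z} : Set P) := by
      have hxz := hxy.trans hyz
      rintro a (rfl | rfl | rfl) b (rfl | rfl | rfl) - <;>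
        first
        | exact Or.inl le_rfl
        | (left; apply le_of_lt; assumption)
        | (right; apply le_of_lt; assumption)
    refine le_trans (le_of_eq ?_)
      (Set.encard_le_chainHeight_of_isChain Set.univ _ (Set.subset_univ _) hc)
    exact (Set.encard_eq_three.2 ⟨x, y, z, hxy.ne, (hxy.trans hyz).ne, hyz.ne, rfl⟩).symm

theorem isPosetFree_iff {P : Type*} [PartialOrder P] [Finite P] {n : ℕ}
    {F : Finset (Finset (Fin n))} :
    IsPosetFree P F ↔ ∀ φ : P → Finset (Fin n), Function.Injective φ → Monotone φ →
      ¬ ∀ x, φ x ∈ F := by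
  constructor
  · intro h φ hinj hmono hF
    cases nonempty_fintype P
    refine h (Finset.univ.image φ) (by simpa [Finset.subset_iff] using hF) ?_
    refine ⟨Equiv.ofBijective (fun x => ⟨φ x, by simp⟩) ⟨?_, ?_⟩, fun x y hxy => hmono hxy⟩
    · intro x y hxy
      exact hinj (by simpa using hxy)
    · rintro ⟨G, hG⟩
      obtain ⟨x, -, rfl⟩ := Finset.mem_image.1 hG
      exact ⟨x, rfl⟩
  · rintro h 𝒢 h𝒢 ⟨φ, hφ⟩
    exact h (fun x => (φ x).1) (fun x y hxy => φ.injective (Subtype.ext hxy)) hφ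
      fun x => h𝒢 (φ x).2

/-- The pairs of members of `F` of which the first is a proper subset of the second. -/
def comparablePairs {n : ℕ} (F : Finset (Finset (Fin n))) :
    Finset (Finset (Fin n) × Finset (Fin n)) :=
  (F ×ˢ F).filter fun p => p.1 ⊂ p.2

theorem mem_comparablePairs {n : ℕ} {F : Finset (Finset (Fin n))}
    {p : Finset (Fin n) × Finset (Fin n)} :
    p ∈ comparablePairs F ↔ (p.1 ∈ F ∧ p.2 ∈ F) ∧ p.1 ⊂ p.2 := by
  simp [comparablePairs]

theorem isCopy_two_iff {n : ℕ} {𝒢 : Finset (Finset (Fin n))} :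
    IsCopy (Fin 2) 𝒢 ↔ ∃ A B, A ⊂ B ∧ 𝒢 = {A, B} := by
  constructor
  · rintro ⟨φ, hφ⟩
    refine ⟨(φ 0).1, (φ 1).1, ?_, ?_⟩
    · refine (hφ 0 1 (by simp)).ssubset_of_ne fun h => ?_
      exact absurd (φ.injective (Subtype.ext h)) (by simp)
    · ext G
      constructor
      · intro hG
        obtain ⟨i, hi⟩ := φ.surjective ⟨G, hG⟩
        have : (φ i).1 = G := congrArg Subtype.val hi
        fin_cases i
        · simp [← this]
        · simp [← this]
      · intro hG
        rcases Finset.mem_insert.1 hG with rfl | hG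
        · exact (φ 0).2
        · rw [Finset.mem_singleton.1 hG]
          exact (φ 1).2
  · rintro ⟨A, B, hAB, rfl⟩
    have hne : A ≠ B := hAB.ne
    refine ⟨Equiv.ofBijective ![⟨A, by simp⟩, ⟨B, by simp⟩] ⟨?_, ?_⟩, ?_⟩
    · intro i j hij
      fin_cases i <;> fin_cases j <;> simp_all [eq_comm]
    · rintro ⟨G, hG⟩
      rcases Finset.mem_insert.1 hG with rfl | hG'
      · exact ⟨0, rfl⟩
      · exact ⟨1, Subtype.ext (Finset.mem_singleton.1 hG').symm⟩
    · intro i j hij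
      fin_cases i <;> fin_cases j
      · exact Finset.Subset.rfl
      · exact hAB.subset
      · exact absurd hij (by simp)
      · exact Finset.Subset.rfl

/-- Inclusion orients a two-element copy, so the unordered set determines the ordered pair. -/
theorem copyCount_two {n : ℕ} (F : Finset (Finset (Fin n))) :
    copyCount (Fin 2) F = (comparablePairs F).card := by
  classical
  rw [copyCount]
  symm
  refine Finset.card_bij (fun p _ => {p.1, p.2}) ?_ ?_ ?_
  · intro p hp
    rw [mem_comparablePairs] at hp
    rw [Finset.mem_filter, Finset.mem_powerset]
    refine ⟨?_, isCopy_two_iff.2 ⟨_, _, hp.2, rfl⟩⟩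
    simp [Finset.insert_subset_iff, hp.1.1, hp.1.2]
  · rintro ⟨A, B⟩ hp ⟨A', B'⟩ hp' h
    have hAB := (mem_comparablePairs.1 hp).2
    have hAB' := (mem_comparablePairs.1 hp').2
    simp only at hAB hAB' h
    have hA : A ∈ ({A', B'} : Finset (Finset (Fin n))) := h ▸ by simp
    have hB : B ∈ ({A', B'} : Finset (Finset (Fin n))) := h ▸ by simp
    simp only [Finset.mem_insert, Finset.mem_singleton] at hA hB
    rcases hA with rfl | rfl <;> rcases hB with rfl | rfl
    · exact absurd hAB (ssubset_irrefl _)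
    · rfl
    · exact absurd hAB (ssubset_asymm hAB')
    · exact absurd hAB (ssubset_irrefl _)
  · intro 𝒢 h𝒢
    rw [Finset.mem_filter, Finset.mem_powerset] at h𝒢
    obtain ⟨A, B, hAB, rfl⟩ := isCopy_two_iff.1 h𝒢.2
    have hs := h𝒢.1
    simp only [Finset.insert_subset_iff, Finset.singleton_subset_iff] at hs
    exact ⟨(A, B), mem_comparablePairs.2 ⟨hs, hAB⟩, rfl⟩

theorem card_comparablePairs_le_La {P : Type*} [PartialOrder P] {n : ℕ}
    {F : Finset (Finset (Fin n))} (hF : IsPosetFree P F) :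
    (comparablePairs F).card ≤ La n P (Fin 2) := by
  classical
  rw [← copyCount_two, La]
  exact Finset.le_sup (f := fun F => copyCount (Fin 2) F) (by simpa using hF)

theorem La_two_le {P : Type*} [PartialOrder P] {n N : ℕ}
    (h : ∀ F : Finset (Finset (Fin n)), IsPosetFree P F → (comparablePairs F).card ≤ N) :
    La n P (Fin 2) ≤ N := by
  classical
  rw [La]
  refine Finset.sup_le fun F hF => ?_
  rw [copyCount_two]
  exact h F (by simpa using hF)

/-- A copy of `Q` restricts along `f` to a copy of `P`, so `P`-free families are `Q`-free. -/
theorem La_two_mono {P Q : Type*} [PartialOrder P] [PartialOrder Q] [Finite P] [Finite Q]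
    (f : P → Q) (hf : Function.Injective f) (hmono : Monotone f) (n : ℕ) :
    La n P (Fin 2) ≤ La n Q (Fin 2) := by
  refine La_two_le fun F hF => card_comparablePairs_le_La ?_
  rw [isPosetFree_iff] at hF ⊢
  exact fun φ hφ hm h => hF (φ ∘ f) (hφ.comp hf) (hm.comp hmono) fun x => h (f x)

theorem La_three_le {P : Type*} [PartialOrder P] [Finite P] (h : 3 ≤ posetHeight P) (n : ℕ) :
    La n (Fin 3) (Fin 2) ≤ La n P (Fin 2) := by
  obtain ⟨x, y, z, hxy, hyz⟩ := three_le_posetHeight_iff.1 h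
  have hs : StrictMono ![x, y, z] := by
    rw [Fin.strictMono_iff_lt_succ]
    intro i
    fin_cases i
    · exact hxy
    · exact hyz
  exact La_two_mono _ hs.injective hs.monotone n

theorem La_le_chain (P : Type*) [PartialOrder P] [Fintype P] (n : ℕ) :
    La n P (Fin 2) ≤ La n (Fin (Fintype.card P)) (Fin 2) := by
  let _ : Fintype (LinearExtension P) := inferInstanceAs (Fintype P)
  let e := (Fintype.orderIsoFinOfCardEq (LinearExtension P)
    (rfl : Fintype.card (LinearExtension P) = Fintype.card P)).symm
  refine La_two_mono (fun x => e (toLinearExtension x)) ?_ ?_ n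
  · exact e.injective.comp fun x y h => h
  · exact e.monotone.comp toLinearExtension.monotone

/-! ### Two full levels: lower bounds for $La(n,P_3,P_2)$ -/

/-- The pairs of a set of size `a` and a proper superset of it of size `b`. -/
def sizePairs (n a b : ℕ) : Finset (Finset (Fin n) × Finset (Fin n)) :=
  Finset.univ.filter fun p => p.1 ⊂ p.2 ∧ p.1.card = a ∧ p.2.card = b

theorem mem_sizePairs {n a b : ℕ} {p : Finset (Fin n) × Finset (Fin n)} :
    p ∈ sizePairs n a b ↔ p.1 ⊂ p.2 ∧ p.1.card = a ∧ p.2.card = b := by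
  simp [sizePairs]

theorem card_sizePairs_le_La (n a b : ℕ) :
    (sizePairs n a b).card ≤ La n (Fin 3) (Fin 2) := by
  let F : Finset (Finset (Fin n)) := Finset.univ.filter fun A => A.card = a ∨ A.card = b
  have hF : IsPosetFree (Fin 3) F := by
    rw [isPosetFree_iff]
    intro φ hinj hmono h
    have hs : StrictMono φ := hmono.strictMono_of_injective hinj
    have h01 := Finset.card_lt_card (hs (show (0 : Fin 3) < 1 by simp))
    have h12 := Finset.card_lt_card (hs (show (1 : Fin 3) < 2 by simp))
    have h0 := (Finset.mem_filter.1 (h 0)).2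
    have h1 := (Finset.mem_filter.1 (h 1)).2
    have h2 := (Finset.mem_filter.1 (h 2)).2
    omega
  refine le_trans (Finset.card_le_card fun p hp => ?_) (card_comparablePairs_le_La hF)
  rw [mem_sizePairs] at hp
  rw [mem_comparablePairs]
  simp [F, hp.1, hp.2.1, hp.2.2]

/-- There are $\sum_B 2^{|B|}=3^n$ pairs $A\subseteq B$, of which $2^n$ have $A=B$. -/
theorem card_all_comparablePairs (n : ℕ) :
    (comparablePairs (Finset.univ : Finset (Finset (Fin n)))).card + 2 ^ n = 3 ^ n := by
  have h : (comparablePairs (Finset.univ : Finset (Finset (Fin n)))).card =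
      ∑ B : Finset (Fin n), B.ssubsets.card := by
    rw [Finset.card_eq_sum_card_fiberwise (f := Prod.snd) (t := Finset.univ) (by simp)]
    refine Finset.sum_congr rfl fun B _ => ?_
    refine Finset.card_bij (fun p _ => p.1) ?_ ?_ ?_
    · intro p hp
      simp only [Finset.mem_filter, mem_comparablePairs] at hp
      rw [Finset.mem_ssubsets, ← hp.2]
      exact hp.1.2
    · intro p hp q hq h
      simp only [Finset.mem_filter] at hp hq
      exact Prod.ext h (hp.2.trans hq.2.symm)
    · intro A hA
      refine ⟨(A, B), ?_, rfl⟩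
      simpa [mem_comparablePairs] using hA
  have h2 : ∑ _B : Finset (Fin n), 1 = 2 ^ n := by simp
  rw [h, ← h2, ← Finset.sum_add_distrib]
  have h3 := Fin.sum_pow_mul_eq_add_pow (n := n) 2 1
  norm_num at h3
  rw [← h3]
  refine Finset.sum_congr rfl fun B _ => ?_
  rw [Finset.ssubsets, Finset.card_erase_of_mem (Finset.mem_powerset_self B),
    Finset.card_powerset]
  have := Nat.one_le_two_pow (n := B.card)
  omega

/-- All comparable pairs are split by their two sizes; each of the $(n+1)^2$ classes lives on at
most two levels. -/
theorem three_pow_le_La (n : ℕ) :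
    3 ^ n ≤ (n + 1) ^ 2 * La n (Fin 3) (Fin 2) + 2 ^ n := by
  rw [← card_all_comparablePairs n]
  gcongr
  rw [Finset.card_eq_sum_card_fiberwise (f := fun p => (p.1.card, p.2.card))
    (t := Finset.range (n + 1) ×ˢ Finset.range (n + 1))]
  · calc _ ≤ ∑ _x ∈ Finset.range (n + 1) ×ˢ Finset.range (n + 1), La n (Fin 3) (Fin 2) := by
          refine Finset.sum_le_sum fun x _ => le_trans (Finset.card_le_card fun p hp => ?_)
            (card_sizePairs_le_La n x.1 x.2)
          simp only [Finset.mem_filter, mem_comparablePairs] at hp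
          rw [mem_sizePairs, ← hp.2]
          exact ⟨hp.1.2, rfl, rfl⟩
      _ = _ := by simp [sq]
  · intro p _
    simp only [Finset.coe_product, Set.mem_prod, Finset.mem_coe, Finset.mem_range]
    have h1 := Finset.card_le_univ p.1
    have h2 := Finset.card_le_univ p.2
    rw [Fintype.card_fin] at h1 h2
    omega

/-! ### Double counting over maximal chains -/

/-- The sizes determine how many points have each membership pattern, so bijections between the
pattern classes glue to a permutation. -/
theorem exists_perm_map_eq {α : Type*} [Fintype α] [DecidableEq α] {A B A' B' : Finset α}
    (hAB : A ⊆ B) (hAB' : A' ⊆ B') (hA : A.card = A'.card) (hB : B.card = B'.card) :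
    ∃ τ : Equiv.Perm α, A.map τ.toEmbedding = A' ∧ B.map τ.toEmbedding = B' := by
  let f : α → Bool × Bool := fun x => (decide (x ∈ A), decide (x ∈ B))
  let g : α → Bool × Bool := fun x => (decide (x ∈ A'), decide (x ∈ B'))
  have fiber : ∀ (A B : Finset α), A ⊆ B → ∀ c : Bool × Bool,
      Fintype.card {x // (decide (x ∈ A), decide (x ∈ B)) = c} =
        bif c.1 then (bif c.2 then A.card else 0) else
          (bif c.2 then B.card - A.card else Fintype.card α - B.card) := by
    rintro A B hAB ⟨p, q⟩
    rw [Fintype.card_subtype]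
    cases p <;> cases q
    · simp only [cond_false]
      rw [← Finset.card_compl]
      congr 1
      ext x
      have := @hAB x
      simp
      tauto
    · simp only [cond_false, cond_true]
      rw [← Finset.card_sdiff_of_subset hAB]
      congr 1
      ext x
      simp
      tauto
    · simp only [cond_false, cond_true, Finset.card_eq_zero]
      ext x
      have := @hAB x
      simp
      tauto
    · simp only [cond_true]
      congr 1
      ext x
      have := @hAB x
      simp
      tauto
  have e : ∀ c, {x // f x = c} ≃ {x // g x = c} := fun c =>
    Fintype.equivOfCardEq (by rw [fiber A B hAB c, fiber A' B' hAB' c, hA, hB])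
  have hτ := Equiv.ofFiberEquiv_map e
  refine ⟨Equiv.ofFiberEquiv e, ?_, ?_⟩
  · refine Finset.eq_of_subset_of_card_le (fun x hx => ?_) (by rw [Finset.card_map, hA])
    obtain ⟨y, hy, rfl⟩ := Finset.mem_map.1 hx
    have := congrArg Prod.fst (hτ y)
    simpa [f, g, hy] using this
  · refine Finset.eq_of_subset_of_card_le (fun x hx => ?_) (by rw [Finset.card_map, hB])
    obtain ⟨y, hy, rfl⟩ := Finset.mem_map.1 hx
    have := congrArg Prod.snd (hτ y)
    simpa [f, g, hy] using this

/-- The set of size `m` on the maximal chain of subsets of `[n]` given by `σ`. -/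
def chainSet {n : ℕ} (σ : Equiv.Perm (Fin n)) (m : ℕ) : Finset (Fin n) :=
  (Finset.univ.filter fun i : Fin n => i.val < m).map σ.toEmbedding

theorem chainSet_mono {n : ℕ} (σ : Equiv.Perm (Fin n)) : Monotone (chainSet σ) := by
  intro a b hab
  refine Finset.map_subset_map.2 fun i => ?_
  simp only [Finset.mem_filter]
  rintro ⟨h, h'⟩
  exact ⟨h, by omega⟩

theorem card_chainSet {n : ℕ} (σ : Equiv.Perm (Fin n)) {m : ℕ} (hm : m ≤ n) :
    (chainSet σ m).card = m := by
  rw [chainSet, Finset.card_map, Fin.card_filter_val_lt, min_eq_right hm]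

/-- The maximal chains through both sets of a pair. -/
def chainsThrough {n : ℕ} (p : Finset (Fin n) × Finset (Fin n)) :
    Finset (Equiv.Perm (Fin n)) :=
  Finset.univ.filter fun σ => chainSet σ p.1.card = p.1 ∧ chainSet σ p.2.card = p.2

theorem mem_chainsThrough {n : ℕ} {p : Finset (Fin n) × Finset (Fin n)}
    {σ : Equiv.Perm (Fin n)} :
    σ ∈ chainsThrough p ↔ chainSet σ p.1.card = p.1 ∧ chainSet σ p.2.card = p.2 := by
  simp [chainsThrough]

theorem card_chainsThrough_le {n : ℕ} {p q : Finset (Fin n) × Finset (Fin n)}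
    (hp : p.1 ⊆ p.2) (hq : q.1 ⊆ q.2) (h1 : p.1.card = q.1.card) (h2 : p.2.card = q.2.card) :
    (chainsThrough p).card ≤ (chainsThrough q).card := by
  obtain ⟨τ, hτ1, hτ2⟩ := exists_perm_map_eq hp hq h1 h2
  refine Finset.card_le_card_of_injOn (fun σ => σ.trans τ) ?_ ?_
  · intro σ hσ
    have hσ := mem_chainsThrough.1 hσ
    have htrans : ∀ m, chainSet (σ.trans τ) m = (chainSet σ m).map τ.toEmbedding := by
      intro m
      rw [chainSet, chainSet, Finset.map_map]
      rfl
    refine mem_chainsThrough.2 ⟨?_, ?_⟩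
    · rw [htrans, ← h1, hσ.1, hτ1]
    · rw [htrans, ← h2, hσ.2, hτ2]
  · intro σ _ σ' _ h
    ext x
    have := congrArg (fun e : Equiv.Perm (Fin n) => e x) h
    simp only [Equiv.trans_apply] at this
    rw [τ.injective this]

/-- Each of the $n!$ chains passes through some pair with the sizes of `p`, and by symmetry all such
pairs lie on equally many chains. -/
theorem factorial_le_mul_card_chainsThrough {n : ℕ} {p : Finset (Fin n) × Finset (Fin n)}
    (hp : p.1 ⊂ p.2) :
    n.factorial ≤ La n (Fin 3) (Fin 2) * (chainsThrough p).card := by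
  have h1 : p.1.card ≤ n := by simpa using Finset.card_le_univ p.1
  have h2 : p.2.card ≤ n := by simpa using Finset.card_le_univ p.2
  have hcover : (Finset.univ : Finset (Equiv.Perm (Fin n))) ⊆
      (sizePairs n p.1.card p.2.card).biUnion chainsThrough := by
    intro σ _
    rw [Finset.mem_biUnion]
    have hlt := Finset.card_lt_card hp
    refine ⟨(chainSet σ p.1.card, chainSet σ p.2.card), mem_sizePairs.2 ⟨?_, ?_, ?_⟩, ?_⟩
    · refine (chainSet_mono σ hlt.le).ssubset_of_ne fun h => hlt.ne ?_
      simpa [card_chainSet, h1, h2] using congrArg Finset.card h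
    · exact card_chainSet σ h1
    · exact card_chainSet σ h2
    · rw [mem_chainsThrough]
      simp [card_chainSet, h1, h2]
  calc n.factorial = (Finset.univ : Finset (Equiv.Perm (Fin n))).card := by
        rw [Finset.card_univ, Fintype.card_perm, Fintype.card_fin]
    _ ≤ ∑ q ∈ sizePairs n p.1.card p.2.card, (chainsThrough q).card :=
        (Finset.card_le_card hcover).trans Finset.card_biUnion_le
    _ ≤ ∑ _q ∈ sizePairs n p.1.card p.2.card, (chainsThrough p).card := by
        refine Finset.sum_le_sum fun q hq => ?_
        rw [mem_sizePairs] at hq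
        exact card_chainsThrough_le hq.1.subset hp.subset hq.2.1 hq.2.2
    _ ≤ _ := by
        rw [Finset.sum_const, smul_eq_mul]
        exact Nat.mul_le_mul_right _ (card_sizePairs_le_La n _ _)

theorem card_chain_lt {n k : ℕ} {F : Finset (Finset (Fin n))} (hF : IsPosetFree (Fin k) F)
    (σ : Equiv.Perm (Fin n)) :
    ((Finset.range (n + 1)).filter fun m => chainSet σ m ∈ F).card < k := by
  by_contra! h
  obtain ⟨S, hS, hcard⟩ := Finset.exists_subset_card_eq h
  have hmem : ∀ i, S.orderEmbOfFin hcard i ≤ n ∧ chainSet σ (S.orderEmbOfFin hcard i) ∈ F := by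
    intro i
    have := Finset.mem_filter.1 (hS (S.orderEmbOfFin_mem hcard i))
    exact ⟨by simpa [Nat.lt_succ_iff] using this.1, this.2⟩
  rw [isPosetFree_iff] at hF
  refine hF (fun i => chainSet σ (S.orderEmbOfFin hcard i)) ?_ ?_ fun i => (hmem i).2
  · intro i j hij
    have := congrArg Finset.card hij
    simp only [card_chainSet σ (hmem _).1] at this
    exact (S.orderEmbOfFin hcard).injective this
  · exact (chainSet_mono σ).comp (S.orderEmbOfFin hcard).monotone

theorem card_middle_pairs_le {n k K : ℕ} (hK : ∀ x y, x + y < k → x * y ≤ K)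
    {F : Finset (Finset (Fin n))} (hF : IsPosetFree (Fin k) F) :
    ((comparablePairs F).filter fun p => 2 * p.1.card < n ∧ n < 2 * p.2.card).card ≤
      K * La n (Fin 3) (Fin 2) := by
  set G := (comparablePairs F).filter fun p => 2 * p.1.card < n ∧ n < 2 * p.2.card with hG
  have hσ : ∀ σ : Equiv.Perm (Fin n), (G.filter fun p => σ ∈ chainsThrough p).card ≤ K := by
    intro σ
    set S := (Finset.range (n + 1)).filter fun m => chainSet σ m ∈ F with hS
    have hSk : S.card < k := card_chain_lt hF σ
    -- The strict inequalities keep the two sides disjoint; a member on the exact middle level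
    -- counts on neither.
    have hsum : (S.filter fun m => 2 * m < n).card + (S.filter fun m => n < 2 * m).card ≤
        S.card := by
      rw [← Finset.card_union_of_disjoint]
      · exact Finset.card_le_card
          (Finset.union_subset (Finset.filter_subset _ _) (Finset.filter_subset _ _))
      · rw [Finset.disjoint_filter]
        intro m _ h
        omega
    refine le_trans ?_ (hK _ _ (lt_of_le_of_lt hsum hSk))
    rw [← Finset.card_product]
    refine Finset.card_le_card_of_injOn (fun p => (p.1.card, p.2.card)) ?_ ?_
    · intro p hp
      simp only [Finset.coe_filter, Set.mem_ofPred_eq, mem_chainsThrough, hG, Finset.mem_filter,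
        mem_comparablePairs] at hp
      have h1 := Finset.card_le_univ p.1
      have h2 := Finset.card_le_univ p.2
      rw [Fintype.card_fin] at h1 h2
      simp only [Finset.coe_product, Set.mem_prod, Finset.mem_coe, Finset.mem_filter, hS,
        Finset.mem_range, hp.2.1, hp.2.2]
      exact ⟨⟨⟨by omega, hp.1.1.1.1⟩, hp.1.2.1⟩, ⟨by omega, hp.1.1.1.2⟩, hp.1.2.2⟩
    · intro p hp q hq h
      simp only [Finset.coe_filter, Set.mem_ofPred_eq, mem_chainsThrough] at hp hq
      simp only [Prod.mk.injEq] at h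
      refine Prod.ext ?_ ?_
      · rw [← hp.2.1, ← hq.2.1, h.1]
      · rw [← hp.2.2, ← hq.2.2, h.2]
  have hcount : ∑ p ∈ G, (chainsThrough p).card ≤ n.factorial * K := by
    calc ∑ p ∈ G, (chainsThrough p).card
        = ∑ p ∈ G, ∑ σ : Equiv.Perm (Fin n), if σ ∈ chainsThrough p then 1 else 0 := by
          refine Finset.sum_congr rfl fun p _ => ?_
          simp
      _ = ∑ σ : Equiv.Perm (Fin n), (G.filter fun p => σ ∈ chainsThrough p).card := by
          rw [Finset.sum_comm]
          refine Finset.sum_congr rfl fun σ _ => ?_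
          rw [Finset.card_filter]
      _ ≤ ∑ _σ : Equiv.Perm (Fin n), K := Finset.sum_le_sum fun σ _ => hσ σ
      _ = n.factorial * K := by simp [Fintype.card_perm]
  refine Nat.le_of_mul_le_mul_right ?_ n.factorial_pos
  calc G.card * n.factorial = ∑ _p ∈ G, n.factorial := by simp
    _ ≤ ∑ p ∈ G, La n (Fin 3) (Fin 2) * (chainsThrough p).card := by
        refine Finset.sum_le_sum fun p hp => factorial_le_mul_card_chainsThrough ?_
        exact (mem_comparablePairs.1 (Finset.mem_filter.1 hp).1).2
    _ = La n (Fin 3) (Fin 2) * ∑ p ∈ G, (chainsThrough p).card := by rw [Finset.mul_sum]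
    _ ≤ La n (Fin 3) (Fin 2) * (n.factorial * K) := Nat.mul_le_mul_left _ hcount
    _ = K * La n (Fin 3) (Fin 2) * n.factorial := by ring

/-! ### Pairs not straddling the middle, and the error term -/

theorem card_low_pairs_le (n : ℕ) :
    ((comparablePairs (Finset.univ : Finset (Finset (Fin n)))).filter
      fun p => 2 * p.2.card ≤ n).card ≤ 2 ^ n * 2 ^ (n / 2) := by
  have hsub : ((comparablePairs (Finset.univ : Finset (Finset (Fin n)))).filter
      fun p => 2 * p.2.card ≤ n) ⊆ (Finset.univ.filter fun B : Finset (Fin n) =>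
        2 * B.card ≤ n).biUnion fun B => B.powerset.image fun A => (A, B) := by
    rintro ⟨A, B⟩ h
    simp only [Finset.mem_filter, mem_comparablePairs] at h
    simp only [Finset.mem_biUnion, Finset.mem_filter, Finset.mem_univ, true_and,
      Finset.mem_image, Finset.mem_powerset]
    exact ⟨B, h.2, A, h.1.2.subset, rfl⟩
  calc _ ≤ _ := Finset.card_le_card hsub
    _ ≤ (Finset.univ.filter fun B : Finset (Fin n) => 2 * B.card ≤ n).card * 2 ^ (n / 2) := by
        refine Finset.card_biUnion_le_card_mul _ _ _ fun B hB => ?_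
        refine Finset.card_image_le.trans ?_
        rw [Finset.card_powerset]
        have := (Finset.mem_filter.1 hB).2
        exact Nat.pow_le_pow_right (by norm_num) (by omega)
    _ ≤ _ := by
        refine Nat.mul_le_mul_right _ ((Finset.card_le_univ _).trans ?_)
        simp

/-- Complementation reverses inclusion and exchanges high pairs with low ones. -/
theorem card_high_pairs_le (n : ℕ) :
    ((comparablePairs (Finset.univ : Finset (Finset (Fin n)))).filter
      fun p => n ≤ 2 * p.1.card).card ≤ 2 ^ n * 2 ^ (n / 2) := by
  refine le_trans ?_ (card_low_pairs_le n)
  refine Finset.card_le_card_of_injOn (fun p => (p.2ᶜ, p.1ᶜ)) ?_ ?_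
  · intro p hp
    simp only [Finset.coe_filter, Set.mem_ofPred_eq, mem_comparablePairs] at hp ⊢
    have h1 := Finset.card_le_univ p.1
    rw [Fintype.card_fin] at h1
    refine ⟨⟨by simp, Finset.compl_ssubset_compl.2 hp.1.2⟩, ?_⟩
    rw [Finset.card_compl, Fintype.card_fin]
    omega
  · rintro ⟨A, B⟩ _ ⟨A', B'⟩ _ h
    simp only [Prod.mk.injEq, compl_inj_iff] at h
    rw [h.1, h.2]

theorem La_chain_le {n k K : ℕ} (hK : ∀ x y, x + y < k → x * y ≤ K) :
    La n (Fin k) (Fin 2) ≤ K * La n (Fin 3) (Fin 2) + 2 * (2 ^ n * 2 ^ (n / 2)) := by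
  refine La_two_le fun F hF => ?_
  have hsub : comparablePairs F ⊆
      ((comparablePairs F).filter fun p => 2 * p.1.card < n ∧ n < 2 * p.2.card) ∪
      (((comparablePairs (Finset.univ : Finset (Finset (Fin n)))).filter
        fun p => 2 * p.2.card ≤ n) ∪
      ((comparablePairs (Finset.univ : Finset (Finset (Fin n)))).filter
        fun p => n ≤ 2 * p.1.card)) := by
    intro p hp
    have := (mem_comparablePairs.1 hp).2
    simp only [Finset.mem_union, Finset.mem_filter, hp, mem_comparablePairs, this,
      Finset.mem_univ, true_and]
    omega
  refine (Finset.card_le_card hsub).trans ((Finset.card_union_le _ _).trans ?_)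
  have h1 := card_middle_pairs_le hK hF
  have h2 := Finset.card_union_le
    ((comparablePairs (Finset.univ : Finset (Finset (Fin n)))).filter
      fun p => 2 * p.2.card ≤ n)
    ((comparablePairs (Finset.univ : Finset (Finset (Fin n)))).filter
      fun p => n ≤ 2 * p.1.card)
  have h3 := card_low_pairs_le n
  have h4 := card_high_pairs_le n
  omega

theorem La_zero (P : Type*) [PartialOrder P] : La 0 P (Fin 2) = 0 := by
  refine Nat.le_zero.1 (La_two_le fun F _ => Nat.le_zero.2 (Finset.card_eq_zero.2 ?_))
  refine Finset.eq_empty_of_forall_notMem fun p hp => (mem_comparablePairs.1 hp).2.ne ?_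
  exact Subsingleton.elim _ _

theorem error_le_mul_La {n : ℕ} (hn : n ≠ 0) :
    (2 * (2 ^ n * 2 ^ (n / 2)) : ℝ) ≤
      24 * ((n : ℝ) ^ 2 * (29 / 30) ^ n) * La n (Fin 3) (Fin 2) := by
  have h1 : (1 : ℝ) ≤ n := by exact_mod_cast Nat.one_le_iff_ne_zero.2 hn
  have h3 : (3 : ℝ) ^ n ≤ (n + 1) ^ 2 * La n (Fin 3) (Fin 2) + 2 ^ n := by
    exact_mod_cast three_pow_le_La n
  have h2 : (2 : ℝ) ^ n ≤ 2 / 3 * 3 ^ n := by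
    obtain ⟨m, rfl⟩ := Nat.exists_eq_succ_of_ne_zero hn
    have : (2 : ℝ) ^ m ≤ 3 ^ m := by gcongr; norm_num
    rw [Nat.succ_eq_add_one, pow_succ, pow_succ]
    linarith
  -- $29/20$ is a rational above $\sqrt2$ whose double is still below $3$; this gives the ratio
  -- $29/30$.
  have hsq : (2 : ℝ) ^ (n / 2) ≤ (29 / 20) ^ n :=
    calc (2 : ℝ) ^ (n / 2) ≤ ((29 / 20) ^ 2) ^ (n / 2) := by gcongr; norm_num
      _ = (29 / 20) ^ (2 * (n / 2)) := by rw [pow_mul]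
      _ ≤ (29 / 20) ^ n := pow_le_pow_right₀ (by norm_num) (Nat.mul_div_le n 2)
  have hc : (0 : ℝ) ≤ La n (Fin 3) (Fin 2) := Nat.cast_nonneg _
  -- By `h2`, $3^n-2^n\ge 3^n/3$; with $(n+1)^2\le4n^2$ this gives $12=3\cdot4$.
  have hpow : (3 : ℝ) ^ n ≤ 12 * n ^ 2 * La n (Fin 3) (Fin 2) := by
    have : ((n : ℝ) + 1) ^ 2 * La n (Fin 3) (Fin 2) ≤
        (4 * n ^ 2) * La n (Fin 3) (Fin 2) := by
      gcongr
      nlinarith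
    linarith
  calc (2 * (2 ^ n * 2 ^ (n / 2)) : ℝ) ≤ 2 * (2 ^ n * (29 / 20) ^ n) := by gcongr
    _ = 2 * ((29 / 30) ^ n * 3 ^ n) := by
        rw [← mul_pow, ← mul_pow]
        norm_num
    _ ≤ 2 * ((29 / 30) ^ n * (12 * n ^ 2 * La n (Fin 3) (Fin 2))) := by gcongr
    _ = _ := by ring

theorem mul_le_floor_sq_div_four {k x y : ℕ} (h : x + y < k) :
    x * y ≤ ⌊((k : ℝ) - 1) ^ 2 / 4⌋.toNat := by
  have hle : ((x * y : ℕ) : ℤ) ≤ ⌊((k : ℝ) - 1) ^ 2 / 4⌋ := by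
    rw [Int.le_floor]
    have h' : (x : ℝ) + y + 1 ≤ k := by exact_mod_cast h
    have hx : (0 : ℝ) ≤ x := Nat.cast_nonneg _
    have hy : (0 : ℝ) ≤ y := Nat.cast_nonneg _
    push_cast
    have hs : ((x : ℝ) + y) ^ 2 ≤ ((k : ℝ) - 1) ^ 2 := by
      gcongr
      linarith
    nlinarith [sq_nonneg ((x : ℝ) - y)]
  omega

theorem exists_La_chain_le (k : ℕ) :
    ∃ ε : ℕ → ℝ, Tendsto ε atTop (𝓝 0) ∧ ∀ n : ℕ, (La n (Fin k) (Fin 2) : ℝ) ≤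
      ((⌊((k : ℝ) - 1) ^ 2 / 4⌋ : ℝ) + ε n) * (La n (Fin 3) (Fin 2) : ℝ) := by
  refine ⟨fun n => 24 * ((n : ℝ) ^ 2 * (29 / 30) ^ n), ?_, fun n => ?_⟩
  · simpa using (tendsto_pow_const_mul_const_pow_of_lt_one 2
      (r := (29 / 30 : ℝ)) (by norm_num) (by norm_num)).const_mul 24
  -- The chosen error vanishes at $n=0$, where `error_le_mul_La` is unavailable, but there both
  -- values of `La` are zero.
  · rcases eq_or_ne n 0 with rfl | hn
    · simp [La_zero]
    · have h : (La n (Fin k) (Fin 2) : ℝ) ≤ (⌊((k : ℝ) - 1) ^ 2 / 4⌋.toNat : ℝ) *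
          La n (Fin 3) (Fin 2) + 2 * (2 ^ n * 2 ^ (n / 2)) := by
        exact_mod_cast La_chain_le (n := n) fun x y h => mul_le_floor_sq_div_four (k := k) h
      have hfloor : (⌊((k : ℝ) - 1) ^ 2 / 4⌋.toNat : ℝ) = (⌊((k : ℝ) - 1) ^ 2 / 4⌋ : ℝ) := by
        have : (0 : ℤ) ≤ ⌊((k : ℝ) - 1) ^ 2 / 4⌋ := Int.floor_nonneg.2 (by positivity)
        exact_mod_cast congrArg (fun z : ℤ => (z : ℝ)) (Int.toNat_of_nonneg this)
      rw [hfloor] at h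
      have := error_le_mul_La hn
      rw [add_mul]
      linarith

theorem La_isTheta_three (P : Type*) [PartialOrder P] [Fintype P] (h : 3 ≤ posetHeight P) :
    (fun n : ℕ => (La n P (Fin 2) : ℝ)) =Θ[atTop]
      fun n : ℕ => (La n (Fin 3) (Fin 2) : ℝ) := by
  constructor
  · obtain ⟨ε, hε, hle⟩ := exists_La_chain_le (Fintype.card P)
    refine IsBigO.of_bound (⌊((Fintype.card P : ℝ) - 1) ^ 2 / 4⌋ + 1) ?_
    filter_upwards [hε.eventually_le_const (zero_lt_one)] with n hn
    rw [Real.norm_natCast, Real.norm_natCast]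
    have h1 : (La n P (Fin 2) : ℝ) ≤ La n (Fin (Fintype.card P)) (Fin 2) := by
      exact_mod_cast La_le_chain P n
    refine h1.trans ((hle n).trans ?_)
    gcongr
  · refine IsBigO.of_bound 1 (Eventually.of_forall fun n => ?_)
    rw [Real.norm_natCast, Real.norm_natCast, one_mul]
    exact_mod_cast La_three_le h n

/-! ### Connected posets: the lower bound -/

theorem choose_succ_half_le (m : ℕ) :
    (m + 1).choose ((m + 1) / 2) ≤ 2 * m.choose (m / 2) := by
  rcases h : (m + 1) / 2 with _ | r
  · have := Nat.choose_pos (Nat.div_le_self m 2)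
    simp
    omega
  · rw [Nat.choose_succ_succ]
    have h1 := Nat.choose_le_middle r m
    have h2 := Nat.choose_le_middle (r + 1) m
    rw [Nat.succ_eq_add_one]
    omega

/-- The only comparable pairs of `F` are $A\subset A\cup\{0\}$. Along a connected Hasse diagram the
set with $0$ erased is constant, leaving room for only two elements of `P`. -/
theorem choose_le_La_of_connected {P : Type*} [PartialOrder P] [Fintype P]
    (hconn : PosetConnected P) (hcard : 3 ≤ Fintype.card P) (m h : ℕ) :
    m.choose h ≤ La (m + 1) P (Fin 2) := by
  classical
  let F : Finset (Finset (Fin (m + 1))) := Finset.univ.filter fun A =>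
    (0 ∉ A ∧ A.card = h) ∨ (0 ∈ A ∧ A.card = h + 1)
  have hpair : ∀ A ∈ F, ∀ B ∈ F, A ⊂ B → A.erase 0 = B.erase 0 := by
    intro A hA B hB hAB
    have hlt := Finset.card_lt_card hAB
    simp only [F, Finset.mem_filter, Finset.mem_univ, true_and] at hA hB
    rcases hA with hA | hA <;> rcases hB with hB | hB
    · omega
    · refine Finset.eq_of_subset_of_card_le (Finset.erase_subset_erase _ hAB.subset) ?_
      rw [Finset.card_erase_of_mem hB.1, Finset.erase_eq_of_notMem hA.1]
      omega
    · omega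
    · omega
  have hF : IsPosetFree P F := by
    rw [isPosetFree_iff]
    intro φ hinj hmono hφ
    have hs : StrictMono φ := hmono.strictMono_of_injective hinj
    have hreach : ∀ x y : P, (φ x).erase 0 = (φ y).erase 0 := by
      intro x y
      obtain ⟨w⟩ := hconn.preconnected x y
      induction w with
      | nil => rfl
      | cons hadj _ ih =>
        refine Eq.trans ?_ ih
        rcases SimpleGraph.hasse_adj.1 hadj with h | h
        · exact hpair _ (hφ _) _ (hφ _) (hs h.lt)
        · exact (hpair _ (hφ _) _ (hφ _) (hs h.lt)).symm
    obtain ⟨x₀⟩ : Nonempty P := Fintype.card_pos_iff.1 (by omega)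
    have himage : Finset.univ.image φ ⊆
        {(φ x₀).erase 0, insert 0 ((φ x₀).erase 0)} := by
      intro A hA
      obtain ⟨x, -, rfl⟩ := Finset.mem_image.1 hA
      rw [Finset.mem_insert, Finset.mem_singleton, hreach x₀ x]
      by_cases h0 : 0 ∈ φ x
      · exact Or.inr (Finset.insert_erase h0).symm
      · exact Or.inl (Finset.erase_eq_of_notMem h0).symm
    have hle := (Finset.card_le_card himage).trans Finset.card_le_two
    rw [Finset.card_image_of_injective _ hinj, Finset.card_univ] at hle
    omega
  refine le_trans ?_ (card_comparablePairs_le_La hF)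
  have hchoose : m.choose h =
      (((Finset.univ : Finset (Fin (m + 1))).erase 0).powersetCard h).card := by
    rw [Finset.card_powersetCard, Finset.card_erase_of_mem (Finset.mem_univ _)]
    simp
  rw [hchoose]
  refine Finset.card_le_card_of_injOn (fun A => (A, insert 0 A)) ?_ ?_
  · intro A hA
    obtain ⟨hA1, hA2⟩ := Finset.mem_powersetCard.1 hA
    have h0 : (0 : Fin (m + 1)) ∉ A := fun h0 => by simpa using hA1 h0
    rw [Finset.mem_coe, mem_comparablePairs]
    refine ⟨⟨?_, ?_⟩, Finset.ssubset_insert h0⟩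
    · simp [F, h0, hA2]
    · simp [F, h0, hA2]
  · intro A _ B _ hAB
    exact congrArg Prod.fst hAB

theorem choose_isBigO_La {P : Type*} [PartialOrder P] [Fintype P]
    (hconn : PosetConnected P) (hcard : 3 ≤ Fintype.card P) :
    (fun n : ℕ => (n.choose (n / 2) : ℝ)) =O[atTop] fun n : ℕ => (La n P (Fin 2) : ℝ) := by
  refine IsBigO.of_bound 2 ?_
  filter_upwards [eventually_ge_atTop 1] with n hn
  obtain ⟨m, rfl⟩ := Nat.exists_eq_add_of_le' hn
  rw [Real.norm_natCast, Real.norm_natCast]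
  exact_mod_cast (choose_succ_half_le m).trans
    (Nat.mul_le_mul_left 2 (choose_le_La_of_connected hconn hcard m (m / 2)))

/-! ### Height at most two: the upper bound -/

/-- Otherwise the minimal elements of `P` can be sent anywhere below $M$ and the others anywhere
above. Without 3-chains every strict relation starts at a minimal element, so this is a copy of `P`.
-/
theorem few_below_or_few_above {P : Type*} [PartialOrder P] [Fintype P]
    (hheight : ¬ 3 ≤ posetHeight P) {n : ℕ} {F : Finset (Finset (Fin n))}
    (hF : IsPosetFree P F) (M : Finset (Fin n)) :
    (F.filter fun A => A ⊆ M).card ≤ Fintype.card P ∨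
      (F.filter fun B => M ⊆ B).card ≤ Fintype.card P := by
  classical
  by_contra! h
  -- Strict excess over $|P|$ pays for deleting $M$, the only set that could lie on both sides.
  have hemb : ∀ S : Finset (Finset (Fin n)), Fintype.card P < S.card →
      ∃ f : P → Finset (Fin n), Function.Injective f ∧ ∀ x, f x ∈ S.erase M := by
    intro S hS
    have hle : Fintype.card P ≤ Fintype.card (S.erase M) := by
      rw [Fintype.card_coe]
      have := Finset.pred_card_le_card_erase (s := S) (a := M)
      omega
    obtain ⟨e⟩ := Function.Embedding.nonempty_of_card_le hle
    exact ⟨fun x => e x, Subtype.val_injective.comp e.injective, fun x => (e x).2⟩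
  obtain ⟨f, hf, hfmem⟩ := hemb _ h.1
  obtain ⟨g, hg, hgmem⟩ := hemb _ h.2
  simp only [Finset.mem_erase, Finset.mem_filter] at hfmem hgmem
  rw [isPosetFree_iff] at hF
  refine hF (fun x => if IsMin x then f x else g x) ?_ ?_ ?_
  · have hne : ∀ x y, f x ≠ g y := fun x y hxy =>
      (hfmem x).1 ((hfmem x).2.2.antisymm (hxy ▸ (hgmem y).2.2))
    intro x y hxy
    by_cases hx : IsMin x <;> by_cases hy : IsMin y <;> simp only [hx, hy, if_true, if_false] at hxy
    · exact hf hxy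
    · exact absurd hxy (hne _ _)
    · exact absurd hxy.symm (hne _ _)
    · exact hg hxy
  · intro x y hxy
    rcases hxy.eq_or_lt with rfl | hlt
    · exact le_rfl
    · have hx : IsMin x := by
        by_contra hx
        obtain ⟨z, hz⟩ := not_isMin_iff.1 hx
        exact hheight (three_le_posetHeight_iff.2 ⟨z, x, y, hz, hlt⟩)
      simp only [hx, hlt.not_isMin, if_true, if_false]
      exact (hfmem x).2.2.trans (hgmem y).2.2
  · intro x
    by_cases hx : IsMin x
    · simpa only [hx, if_true] using (hfmem x).2.1
    · simpa only [hx, if_false] using (hgmem x).2.1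

theorem exists_switch {α : Type*} [DecidableEq α] {p : Finset α → Prop} {A B : Finset α}
    (hAB : A ⊆ B) (hA : p A) (hB : ¬ p B) :
    ∃ M x, A ⊆ M ∧ insert x M ⊆ B ∧ p M ∧ ¬ p (insert x M) := by
  classical
  obtain ⟨M, hM, hmax⟩ := ((Finset.Icc A B).filter p).exists_max_image Finset.card
    ⟨A, by simp [hA, hAB]⟩
  simp only [Finset.mem_filter, Finset.mem_Icc] at hM hmax
  have hMB : M ⊂ B := hM.1.2.ssubset_of_ne fun h => hB (h ▸ hM.2)
  obtain ⟨x, hxB, hxM⟩ := Finset.exists_of_ssubset hMB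
  have hins : insert x M ⊆ B := Finset.insert_subset hxB hM.1.2
  refine ⟨M, x, hM.1.1, hins, hM.2, fun hp => ?_⟩
  have := hmax _ ⟨⟨hM.1.1.trans (Finset.subset_insert _ _), hins⟩, hp⟩
  rw [Finset.card_insert_of_notMem hxM] at this
  omega

/-- If $B$ has few members below it, or $A$ few above, the pair is charged to that set, at most $p$
times. Otherwise $A$ is low and $B$ is not, and between them some edge $M\subset M\cup\{x\}$ leaves
`low`: at most $p$ choices of $A$ below $M$ and $p$ of $B$ above $M\cup\{x\}$. -/
theorem card_comparablePairs_le_of_few {n p : ℕ} {F : Finset (Finset (Fin n))}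
    (h : ∀ M : Finset (Fin n), (F.filter fun A => A ⊆ M).card ≤ p ∨
      (F.filter fun B => M ⊆ B).card ≤ p) :
    (comparablePairs F).card ≤ 2 ^ n * p + (2 ^ n * p + 2 ^ n * n * (p * p)) := by
  classical
  let D : Finset (Fin n) → Finset (Finset (Fin n)) := fun M => F.filter fun A => A ⊆ M
  let U : Finset (Fin n) → Finset (Finset (Fin n)) := fun M => F.filter fun B => M ⊆ B
  let low : Finset (Finset (Fin n)) := Finset.univ.filter fun M => (D M).card ≤ p
  let high : Finset (Finset (Fin n)) := Finset.univ.filter fun M => (U M).card ≤ p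
  let edges : Finset (Finset (Fin n) × Fin n) := Finset.univ.filter fun e =>
    e.1 ∈ low ∧ insert e.2 e.1 ∈ high
  have hsub : comparablePairs F ⊆
      (low.biUnion fun B => (D B).image fun A => (A, B)) ∪
      ((high.biUnion fun A => (U A).image fun B => (A, B)) ∪
        edges.biUnion fun e => D e.1 ×ˢ U (insert e.2 e.1)) := by
    rintro ⟨A, B⟩ hAB
    rw [mem_comparablePairs] at hAB
    obtain ⟨⟨hA, hB⟩, hAB⟩ := hAB
    simp only at hA hB hAB
    have hor : ∀ M, M ∉ low → M ∈ high := by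
      intro M hM
      simp only [low, high, Finset.mem_filter, Finset.mem_univ, true_and] at hM ⊢
      exact (h M).resolve_left hM
    by_cases hBl : B ∈ low
    · refine Finset.mem_union_left _ (Finset.mem_biUnion.2 ⟨B, hBl, ?_⟩)
      exact Finset.mem_image.2 ⟨A, Finset.mem_filter.2 ⟨hA, hAB.subset⟩, rfl⟩
    refine Finset.mem_union_right _ ?_
    by_cases hAl : A ∈ low
    · obtain ⟨M, x, hAM, hMB, hM, hxM⟩ := exists_switch (p := (· ∈ low)) hAB.subset hAl hBl
      refine Finset.mem_union_right _ (Finset.mem_biUnion.2 ⟨(M, x), ?_, ?_⟩)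
      · exact Finset.mem_filter.2 ⟨Finset.mem_univ _, hM, hor _ hxM⟩
      · exact Finset.mem_product.2
          ⟨Finset.mem_filter.2 ⟨hA, hAM⟩, Finset.mem_filter.2 ⟨hB, hMB⟩⟩
    · refine Finset.mem_union_left _ (Finset.mem_biUnion.2 ⟨A, hor A hAl, ?_⟩)
      exact Finset.mem_image.2 ⟨B, Finset.mem_filter.2 ⟨hB, hAB.subset⟩, rfl⟩
  have hcard : ∀ S : Finset (Finset (Fin n)), S.card ≤ 2 ^ n := fun S =>
    (Finset.card_le_univ S).trans (by simp)
  have hedges : edges.card ≤ 2 ^ n * n := (Finset.card_le_univ edges).trans (by simp)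
  refine (Finset.card_le_card hsub).trans ((Finset.card_union_le _ _).trans
    (add_le_add ?_ ((Finset.card_union_le _ _).trans (add_le_add ?_ ?_))))
  · refine (Finset.card_biUnion_le_card_mul low _ p fun B hB => ?_).trans
      (Nat.mul_le_mul_right _ (hcard _))
    exact Finset.card_image_le.trans (Finset.mem_filter.1 hB).2
  · refine (Finset.card_biUnion_le_card_mul high _ p fun A hA => ?_).trans
      (Nat.mul_le_mul_right _ (hcard _))
    exact Finset.card_image_le.trans (Finset.mem_filter.1 hA).2
  · refine (Finset.card_biUnion_le_card_mul edges _ (p * p) fun e he => ?_).trans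
      (Nat.mul_le_mul_right _ hedges)
    have he := (Finset.mem_filter.1 he).2
    rw [Finset.card_product]
    exact Nat.mul_le_mul (Finset.mem_filter.1 he.1).2 (Finset.mem_filter.1 he.2).2

theorem La_isBigO_of_height_le_two {P : Type*} [PartialOrder P] [Fintype P]
    (hheight : ¬ 3 ≤ posetHeight P) :
    (fun n : ℕ => (La n P (Fin 2) : ℝ)) =O[atTop] fun n : ℕ => (n : ℝ) * 2 ^ n := by
  set p := Fintype.card P with hp
  refine IsBigO.of_bound (2 * p + p * p) ?_
  filter_upwards [eventually_ge_atTop 1] with n hn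
  have h : La n P (Fin 2) ≤ 2 ^ n * p + (2 ^ n * p + 2 ^ n * n * (p * p)) :=
    La_two_le fun F hF => card_comparablePairs_le_of_few fun M =>
      few_below_or_few_above hheight hF M
  have h' : La n P (Fin 2) ≤ (2 * p + p * p) * (n * 2 ^ n) := by
    have : 2 ^ n * p * 1 ≤ 2 ^ n * p * n := Nat.mul_le_mul_left _ hn
    nlinarith
  rw [Real.norm_natCast, Real.norm_of_nonneg (by positivity)]
  exact_mod_cast h'

theorem theorem1p3 (P : Type*) [PartialOrder P] [Fintype P] :
    (3 ≤ posetHeight P →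
      ((fun n : ℕ => (La n P (Fin 2) : ℝ)) =Θ[atTop] fun n : ℕ => (La n (Fin 3) (Fin 2) : ℝ)) ∧
      (∀ n : ℕ, La n (Fin 3) (Fin 2) ≤ La n P (Fin 2) ∧
        La n P (Fin 2) ≤ La n (Fin (Fintype.card P)) (Fin 2)) ∧
      ∃ ε : ℕ → ℝ, Tendsto ε atTop (𝓝 0) ∧
        ∀ n : ℕ, (La n (Fin (Fintype.card P)) (Fin 2) : ℝ) ≤
          ((⌊((Fintype.card P : ℝ) - 1) ^ 2 / 4⌋ : ℝ) + ε n) * (La n (Fin 3) (Fin 2) : ℝ)) ∧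
    (PosetConnected P → posetHeight P = 2 → 3 ≤ Fintype.card P →
      ((fun n : ℕ => (n.choose (n / 2) : ℝ)) =O[atTop] fun n : ℕ => (La n P (Fin 2) : ℝ)) ∧
      ((fun n : ℕ => (La n P (Fin 2) : ℝ)) =O[atTop] fun n : ℕ => (n : ℝ) * 2 ^ n)) := by
  refine ⟨fun h => ⟨La_isTheta_three P h, fun n => ⟨La_three_le h n, La_le_chain P n⟩,
    exists_La_chain_le _⟩, fun hconn hheight hcard => ⟨choose_isBigO_La hconn hcard, ?_⟩⟩
  refine La_isBigO_of_height_le_two ?_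
  rw [hheight]
  decide
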